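/- **Setting.** Let $\Omega\subset\mathbb{R}^d$ be a closed regular cone, i.e. a closed convex set, invariant under multiplication by positive scalars, with $\Omega\cap(-\Omega)=\{0\}$ and non-empty interior, and let $G(\Omega)=\{g\in GL_d(\mathbb{R}) : g\Omega=\Omega\}$. A *causal structure* on a smooth $d$-dimensional manifold $N$ is a reduction of the structure group of $TN$ from $GL_d(\mathbb{R})$ to $G(\Omega)$; its *cone field* $\mathcal C$ is the associated bundle with fibre $\Omega$, so $\mathcal C_x\subset T_xN$. A piecewise smooth curve $\gamma:[a,b]\to N$ ($a<b$; continuous, and $C^\infty$ on the finitely many open intervals of some partition of $[a,b]$) is *causal* if $\dot\gamma(t)\in\mathcal C_{\gamma(t)}$ for all but finitely many $t$. Write $x\preceq_s y$ if there is a causal curve from $x$ to $y$, and let $\preceq$ be the closure of $\preceq_s$ in $N\times N$. The pair $(N,\mathcal C)$ is *causal* if $\preceq$ is a partial order, and *totally acausal* if $\preceq$ is all of $N\times N$. A *causal diffeomorphism* of $(N,\mathcal C)$ is a diffeomorphism $\phi$ with $d\phi(\mathcal C_x)=\mathcal C_{\phi(x)}$ for all $x$. Let $(\widetilde M,\widetilde{\mathcal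 C})$ be a causal manifold, let $T$ be a causal diffeomorphism of $(\widetilde M,\widetilde{\mathcal C})$ of infinite order such that $\Gamma=\langle T\rangle\cong\mathbb{Z}$ acts properly discontinuously on $\widetilde M$, and let $p:\widetilde M\to M=\Gamma\backslash\widetilde M$ be the quotient covering, where $M$ carries the induced smooth structure and the induced causal structure, with cone field $\mathcal C_{p(x)}=dp_x(\widetilde{\mathcal C}_x)$. The map $p$ is called a *causal covering* if $(M,\mathcal C)$ is totally acausal, and a *complete* causal covering if moreover $x\preceq Tx$ for all $x\in\widetilde M$. A causal covering is *quasi-total* if $(\widetilde M,\preceq,T)$ is a quasi-total triple, i.e. $T$ is an automorphism of the poset $(\widetilde M,\preceq)$ which is dominant (for all $a,b\in\widetilde M$ there is $n\ge 1$ with $T^na\succ b$), and there is $N\in\mathbb{N}$ such that for all $a,b\in\widetilde M$ there is $0\le k\le N$ with $a\preceq T^kb$ or $b\preceq T^ka$. **Theorem.** If $M$ is compact, then every complete causal covering $p:\widetilde M\to M$ is quasi-total. -/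

import Mathlib

open Set Topology
open scoped Manifold ContDiff

/-! ### Quasi-total triples -/

namespace QuasiTotal

/-- `T` is a dominant permutation of `(X, ≼)`: for all `a, b` some positive power satisfies
`Tⁿ a ≻ b` (strictly). -/
def IsDominant {X : Type*} (r : X → X → Prop) (T : Equiv.Perm X) : Prop :=
  ∀ a b : X, ∃ n : ℕ, 0 < n ∧ r b ((T ^ n) a) ∧ b ≠ (T ^ n) a

/-- `(X, ≼, T)` is a quasi-total triple: `≼` is a partial order, `T` is a dominant
order-automorphism, and there is a uniform `N` such that any two points `a, b` satisfy
`a ≼ Tᵏ b` or `b ≼ Tᵏ a` for some `0 ≤ k ≤ N`. -/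
structure IsQuasiTotalTriple {X : Type*} (r : X → X → Prop) (T : Equiv.Perm X) : Prop where
  isPartialOrder : IsPartialOrder X r
  isAutomorphism : ∀ x y : X, r (T x) (T y) ↔ r x y
  isDominant : IsDominant r T
  uniform_bound : ∃ N : ℕ, ∀ a b : X, ∃ k : ℕ, k ≤ N ∧ (r a ((T ^ k) b) ∨ r b ((T ^ k) a))

/-! ### Closed regular cones and causal structures -/

/-- A closed regular cone in a topological vector space: a closed convex subset, invariant under
positive scalars, pointed, with non-empty interior. -/
structure IsClosedRegularCone {V : Type*} [AddCommGroup V] [Module ℝ V] [TopologicalSpace V]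
    (Ω : Set V) : Prop where
  convex : Convex ℝ Ω
  smul_mem : ∀ t : ℝ, 0 < t → ∀ v ∈ Ω, t • v ∈ Ω
  isClosed : IsClosed Ω
  pointed : Ω ∩ {v | -v ∈ Ω} = {0}
  regular : (interior Ω).Nonempty

/-- The group `G(Ω) = {g ∈ GL(ℝᵈ) | g Ω = Ω}`. -/
def coneGroup {d : ℕ} (Ω : Set (EuclideanSpace ℝ (Fin d))) :
    Subgroup (EuclideanSpace ℝ (Fin d) ≃L[ℝ] EuclideanSpace ℝ (Fin d)) where
  carrier := {g | g '' Ω = Ω}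
  one_mem' := by
    change (fun x => x) '' Ω = Ω
    simp
  mul_mem' := by
    intro a b ha hb
    have h : (⇑(a * b)) = a ∘ b := rfl
    simp only [mem_ofPred_eq] at ha hb ⊢
    rw [h, image_comp, hb, ha]
  inv_mem' := by
    intro a ha
    simp only [mem_ofPred_eq] at ha ⊢
    have h : (⇑(a⁻¹)) = a.symm := rfl
    rw [h]
    nth_rewrite 1 [← ha]
    rw [← image_comp]
    simp

/-- A causal structure modelled on `Ω` on the `d`-dimensional smooth manifold `M`: a reduction of
the structure group of `TM` from `GL_d(ℝ)` to `G(Ω)`. It is given as a principal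
`G(Ω)`-subbundle of the bundle of linear frames `ℝᵈ ≃ T_x M`: every fibre is a
`G(Ω)`-orbit, and there are smooth local sections. -/
structure CausalStructure {d : ℕ} (Ω : Set (EuclideanSpace ℝ (Fin d)))
    (M : Type*) [TopologicalSpace M] [ChartedSpace (EuclideanSpace ℝ (Fin d)) M]
    [IsManifold (𝓡 d) ∞ M] where
  /-- the fibre over `x` of the principal bundle -/
  frames : ∀ x : M, Set (EuclideanSpace ℝ (Fin d) ≃L[ℝ] TangentSpace (𝓡 d) x)
  /-- `G(Ω)` acts on each fibre by precomposition, and transitively -/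
  mem_frames_iff : ∀ x : M, ∀ f ∈ frames x,
    ∀ f' : EuclideanSpace ℝ (Fin d) ≃L[ℝ] TangentSpace (𝓡 d) x,
      f' ∈ frames x ↔ ∃ g ∈ coneGroup Ω, ∀ v, f' v = f (g v)
  /-- existence of smooth local sections (in particular the fibres are non-empty) -/
  exists_local_section : ∀ x₀ : M, ∃ U : Set M, IsOpen U ∧ x₀ ∈ U ∧
    ∃ e : ∀ x : M, EuclideanSpace ℝ (Fin d) ≃L[ℝ] TangentSpace (𝓡 d) x,
      (∀ x ∈ U, e x ∈ frames x) ∧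
      ∀ v : EuclideanSpace ℝ (Fin d),
        ContMDiffOn (𝓡 d) (𝓡 d).tangent ∞
          (fun x => (⟨x, e x v⟩ : TangentBundle (𝓡 d) M)) U

namespace CausalStructure

variable {d : ℕ} {Ω : Set (EuclideanSpace ℝ (Fin d))}
  {M : Type*} [TopologicalSpace M] [ChartedSpace (EuclideanSpace ℝ (Fin d)) M]
  [IsManifold (𝓡 d) ∞ M]

/-- The cone field of a causal structure: the associated bundle with fibre `Ω`. -/
def coneField (C : CausalStructure Ω M) (x : M) : Set (TangentSpace (𝓡 d) x) :=
  {v | ∃ f ∈ C.frames x, ∃ w ∈ Ω, v = f w}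

/-! ### Causal curves and causalities -/

/-- `γ : [a, b] → M` is piecewise smooth: continuous on `[a, b]`, and `C^∞` on the open intervals
of `(a, b)` cut out by finitely many points. -/
def IsPiecewiseSmooth (γ : ℝ → M) (a b : ℝ) : Prop :=
  ContinuousOn γ (Icc a b) ∧
    ∃ S : Set ℝ, S.Finite ∧ ContMDiffOn 𝓘(ℝ, ℝ) (𝓡 d) ∞ γ (Ioo a b \ S)

/-- The velocity `γ'(t)`. -/
noncomputable def velocity (γ : ℝ → M) (t : ℝ) : TangentSpace (𝓡 d) (γ t) :=
  mfderiv 𝓘(ℝ, ℝ) (𝓡 d) γ t (1 : ℝ)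

/-- `γ : [a, b] → M` is a causal curve: piecewise smooth, with `γ'(t)` in the cone at `γ(t)` for
all but finitely many `t ∈ [a, b]`. -/
def IsCausalCurve (C : CausalStructure Ω M) (γ : ℝ → M) (a b : ℝ) : Prop :=
  IsPiecewiseSmooth (d := d) γ a b ∧
    {t ∈ Icc a b | velocity (d := d) γ t ∉ C.coneField (γ t)}.Finite

/-- The strict causality `x ≼ₛ y`: some causal curve runs from `x` to `y`. -/
def StrictCausality (C : CausalStructure Ω M) (x y : M) : Prop :=
  ∃ (a b : ℝ) (γ : ℝ → M), a < b ∧ C.IsCausalCurve γ a b ∧ γ a = x ∧ γ b = y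

/-- The (closed) causality `x ≼ y`: the closure of the strict causality in `M × M`. -/
def Causality (C : CausalStructure Ω M) (x y : M) : Prop :=
  (x, y) ∈ closure {q : M × M | C.StrictCausality q.1 q.2}

/-- `(M, C)` is causal: the closed causality is a partial order. -/
def IsCausal (C : CausalStructure Ω M) : Prop :=
  IsPartialOrder M C.Causality

/-- `(M, C)` is totally acausal: the closed causality is all of `M × M`. -/
def IsTotallyAcausal (C : CausalStructure Ω M) : Prop :=
  ∀ x y : M, C.Causality x y

/-- The group `G(M, C)` of causal diffeomorphisms of `(M, C)`. -/
def causalGroup (C : CausalStructure Ω M) : Subgroup (Equiv.Perm M) where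
  carrier := {φ | ContMDiff (𝓡 d) (𝓡 d) ∞ φ ∧ ContMDiff (𝓡 d) (𝓡 d) ∞ φ.symm ∧
    ∀ x : M, mfderiv (𝓡 d) (𝓡 d) φ x '' C.coneField x = C.coneField (φ x)}
  one_mem' := by
    refine ⟨contMDiff_id, contMDiff_id, fun x => ?_⟩
    change mfderiv (𝓡 d) (𝓡 d) (id : M → M) x '' C.coneField x = C.coneField x
    rw [mfderiv_id]
    exact image_id _
  mul_mem' := by
    rintro φ ψ ⟨h1, h2, h3⟩ ⟨k1, k2, k3⟩
    refine ⟨h1.comp k1, k2.comp h2, fun x => ?_⟩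
    change mfderiv (𝓡 d) (𝓡 d) (φ ∘ ψ) x '' C.coneField x = C.coneField (φ (ψ x))
    rw [mfderiv_comp x (h1.mdifferentiable (by simp) _) (k1.mdifferentiable (by simp) _),
      ← h3, ← k3]
    exact image_comp (mfderiv (𝓡 d) (𝓡 d) φ (ψ x)) (mfderiv (𝓡 d) (𝓡 d) ψ x) (C.coneField x)
  inv_mem' := by
    rintro φ ⟨h1, h2, h3⟩
    refine ⟨h2, h1, fun x => ?_⟩
    change mfderiv (𝓡 d) (𝓡 d) φ.symm x '' C.coneField x = C.coneField (φ.symm x)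
    obtain ⟨y, rfl⟩ := φ.surjective x
    have hc := mfderiv_comp y (I'' := 𝓡 d) (I' := 𝓡 d) (I := 𝓡 d)
      (h2.mdifferentiable (by simp) (φ y)) (h1.mdifferentiable (by simp) y)
    have hid : φ.symm ∘ φ = id := by ext z; simp
    rw [hid, mfderiv_id] at hc
    rw [← h3, ← image_comp, Equiv.symm_apply_apply]
    refine (image_congr fun v _ => ?_).trans (image_id _)
    exact (DFunLike.congr_fun hc v).symm

end CausalStructure

/-! ### Causal coverings -/

section Coverings

variable {d : ℕ} {Ω : Set (EuclideanSpace ℝ (Fin d))}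
  {Mt : Type*} [TopologicalSpace Mt] [ChartedSpace (EuclideanSpace ℝ (Fin d)) Mt]
  [IsManifold (𝓡 d) ∞ Mt]
  {M : Type*} [TopologicalSpace M] [ChartedSpace (EuclideanSpace ℝ (Fin d)) M]
  [IsManifold (𝓡 d) ∞ M]

/-- `p : Mt → M` is a causal covering with deck group `Γ = ⟨T⟩`: `(Mt, Ct)` is a causal manifold,
`T` is a causal diffeomorphism of infinite order, `Γ` acts properly discontinuously,
`p` is the quotient map onto the quotient manifold `M = Γ \ Mt`
(carrying the smooth structure and the cone field for which `p` is a local diffeomorphism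
preserving cones), and `M` is totally acausal. -/
structure IsCausalCovering (Ct : CausalStructure Ω Mt) (C : CausalStructure Ω M)
    (T : Ct.causalGroup) (p : Mt → M) : Prop where
  isCausal : Ct.IsCausal
  infinite_order : ¬ IsOfFinOrder T
  /-- every point has a neighbourhood whose `Γ`-translates are pairwise disjoint,
  and `p` is the topological quotient by `Γ` -/
  isQuotientCoveringMap : IsQuotientCoveringMap p (Subgroup.zpowers T)
  isLocalDiffeomorph : IsLocalDiffeomorph (𝓡 d) (𝓡 d) ∞ p
  map_coneField : ∀ x : Mt,
    mfderiv (𝓡 d) (𝓡 d) p x '' Ct.coneField x = C.coneField (p x)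
  isTotallyAcausal : C.IsTotallyAcausal

/-- A causal covering is complete if `x ≼ T x` for all `x`. -/
structure IsCompleteCausalCovering (Ct : CausalStructure Ω Mt) (C : CausalStructure Ω M)
    (T : Ct.causalGroup) (p : Mt → M) : Prop extends IsCausalCovering Ct C T p where
  complete : ∀ x : Mt, Ct.Causality x ((T : Equiv.Perm Mt) x)

/-- A causal covering is quasi-total if `(Mt, ≼, T)` is a quasi-total triple. -/
structure IsQuasiTotalCausalCovering (Ct : CausalStructure Ω Mt) (C : CausalStructure Ω M)
    (T : Ct.causalGroup) (p : Mt → M) : Prop extends IsCausalCovering Ct C T p where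
  isQuasiTotalTriple : IsQuasiTotalTriple Ct.Causality (T : Equiv.Perm Mt)

end Coverings

end QuasiTotal

/-! The difficulty is that `≼` is only a closure, whereas path lifting applies to actual causal
curves. Since `Ω` has interior, every point has a nearby future point and a nearby past point to
which it is joined by causal curves, stably under perturbation of both endpoints
(`exists_eventually_strictCausality`). This room absorbs the closure: total acausality of `M` yields
a genuine causal curve between points near prescribed ones, which lifts by
`StrictCausality.exists_lift`. Hence `a ≼ T^k b` for some integer `k` (`exists_causality_zpow`), and
completeness allows `k` to be increased to a natural number.

Dominance then follows because `T` has no fixed points. For the uniform bound, fix `o`: each `x` is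
squeezed between powers of `T` and `o`, with exponents valid on a whole neighbourhood of `x`.
Compactness of `M` makes them uniform up to deck translation, and comparing two points through `o`
gives the bound (`exists_uniform_bound_of_locally`). -/

namespace QuasiTotal
namespace CausalStructure

/-! ### Local causal geometry in a chart -/

open Filter

variable {d : ℕ} {Ω : Set (EuclideanSpace ℝ (Fin d))}
  {M : Type*} [TopologicalSpace M] [ChartedSpace (EuclideanSpace ℝ (Fin d)) M]
  [IsManifold (𝓡 d) ∞ M]

/-- In the chart at `x₀`, the cones at all points near `x₀` contain a common open set. -/
theorem exists_eventually_mem_image_coneField (hΩ : (interior Ω).Nonempty)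
    (C : CausalStructure Ω M) (x₀ : M) :
    ∃ v : EuclideanSpace ℝ (Fin d), ∀ᶠ q : M × EuclideanSpace ℝ (Fin d) in 𝓝 (x₀, v),
      q.1 ∈ (extChartAt (𝓡 d) x₀).source ∧ ∃ w ∈ C.coneField q.1,
        mfderiv (𝓡 d) 𝓘(ℝ, EuclideanSpace ℝ (Fin d)) (extChartAt (𝓡 d) x₀) q.1 w = q.2 := by
  obtain ⟨w₀, hw₀⟩ := hΩ
  obtain ⟨U, hU, hxU, e, he, hsm⟩ := C.exists_local_section x₀
  -- `A y` is a local frame read in the chart. With `w₀` interior to `Ω`, the direction sought is `A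
  -- x₀ w₀`: continuity of `A` and of inversion keeps `(A y)⁻¹ u` interior for `(y, u)` nearby.
  let A : M → EuclideanSpace ℝ (Fin d) →L[ℝ] EuclideanSpace ℝ (Fin d) := fun y =>
    (mfderiv (𝓡 d) 𝓘(ℝ, EuclideanSpace ℝ (Fin d)) (extChartAt (𝓡 d) x₀) y).comp
      (e y : EuclideanSpace ℝ (Fin d) →L[ℝ] TangentSpace (𝓡 d) y)
  have hinv : ∀ y ∈ (extChartAt (𝓡 d) x₀).source, (A y).IsInvertible := fun y hy =>
    (isInvertible_mfderiv_extChartAt hy).comp ⟨e y, rfl⟩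
  have hsrc : ∀ᶠ y in 𝓝 x₀, y ∈ (extChartAt (𝓡 d) x₀).source :=
    (isOpen_extChartAt_source x₀).mem_nhds (mem_extChartAt_source x₀)
  have hA : ContinuousAt A x₀ := by
    refine continuousAt_clm_apply.2 fun w => ?_
    have h1 := ((Bundle.contMDiffAt_section _).1
      ((hsm w).contMDiffAt (hU.mem_nhds hxU))).continuousAt
    refine h1.congr ?_
    filter_upwards [hsrc] with y hy
    rw [extChartAt_source] at hy
    have h2 := TangentBundle.continuousLinearMapAt_trivializationAt (𝕜 := ℝ) (I := 𝓡 d) hy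
    have h3 : (trivializationAt (EuclideanSpace ℝ (Fin d)) (TangentSpace (𝓡 d)) x₀
        ).continuousLinearMapAt ℝ y (e y w) =
        (trivializationAt (EuclideanSpace ℝ (Fin d)) (TangentSpace (𝓡 d)) x₀ ⟨y, e y w⟩).2 := by
      rw [Bundle.Trivialization.continuousLinearMapAt_apply,
        Bundle.Trivialization.linearMapAt_apply, if_pos (by simpa using hy)]
    exact h3.symm.trans (DFunLike.congr_fun h2 (e y w))
  obtain ⟨A₀, hA₀⟩ := hinv x₀ (mem_extChartAt_source x₀)
  have hcont : ContinuousAt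
      (fun q : M × EuclideanSpace ℝ (Fin d) => (A q.1).inverse q.2) (x₀, A x₀ w₀) := by
    have h1 : ContinuousAt ContinuousLinearMap.inverse (A x₀) := by
      rw [← hA₀]
      exact (contDiffAt_map_inverse (n := 0) A₀).continuousAt
    have h2 : ContinuousAt (fun y => (A y).inverse) x₀ :=
      ContinuousAt.comp (g := ContinuousLinearMap.inverse) h1 hA
    exact ((h2.comp_of_eq continuousAt_fst rfl :
      ContinuousAt ((fun y => (A y).inverse) ∘ Prod.fst) (x₀, A x₀ w₀))).clm_apply
        continuousAt_snd
  refine ⟨A x₀ w₀, ?_⟩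
  have hval : (A x₀).inverse (A x₀ w₀) = w₀ := by
    rw [← hA₀]; simp
  have hΩ' : ∀ᶠ q : M × EuclideanSpace ℝ (Fin d) in 𝓝 (x₀, A x₀ w₀),
      (A q.1).inverse q.2 ∈ interior Ω :=
    hcont (by simpa only [hval] using isOpen_interior.mem_nhds hw₀)
  filter_upwards [hΩ', (continuousAt_fst (p := (x₀, A x₀ w₀))).eventually hsrc,
    (continuousAt_fst (p := (x₀, A x₀ w₀))).eventually (hU.mem_nhds hxU)] with q h1 h2 h3
  refine ⟨h2, e q.1 ((A q.1).inverse q.2),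
    ⟨e q.1, he _ h3, _, interior_subset h1, rfl⟩, ?_⟩
  obtain ⟨B, hB⟩ := hinv q.1 h2
  change A q.1 ((A q.1).inverse q.2) = q.2
  rw [← hB]; simp

/-- A segment in a chart whose direction lies in the cones along it is a causal curve. -/
theorem strictCausality_of_segment (C : CausalStructure Ω M) (x₀ : M)
    {z u : EuclideanSpace ℝ (Fin d)} {t : ℝ} (ht : 0 < t)
    (h : ∀ s ∈ Icc 0 t, z + s • u ∈ (extChartAt (𝓡 d) x₀).target ∧
      ∃ w ∈ C.coneField ((extChartAt (𝓡 d) x₀).symm (z + s • u)),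
        mfderiv (𝓡 d) 𝓘(ℝ, EuclideanSpace ℝ (Fin d)) (extChartAt (𝓡 d) x₀)
          ((extChartAt (𝓡 d) x₀).symm (z + s • u)) w = u) :
    C.StrictCausality ((extChartAt (𝓡 d) x₀).symm z)
      ((extChartAt (𝓡 d) x₀).symm (z + t • u)) := by
  set φ := extChartAt (𝓡 d) x₀
  have hopen : IsOpen φ.target := isOpen_extChartAt_target x₀
  have hsymm : ∀ y ∈ φ.target, ContMDiffAt 𝓘(ℝ, EuclideanSpace ℝ (Fin d)) (𝓡 d) ∞ φ.symm y :=
    fun y hy => (contMDiffOn_extChartAt_symm x₀).contMDiffAt (hopen.mem_nhds hy)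
  have hline : ContDiff ℝ ∞ fun s : ℝ => z + s • u := by fun_prop
  have hγ : ∀ s ∈ Icc 0 t, ContMDiffAt 𝓘(ℝ, ℝ) (𝓡 d) ∞ (fun s => φ.symm (z + s • u)) s :=
    fun s hs => (hsymm _ (h s hs).1).comp s hline.contMDiff.contMDiffAt
  refine ⟨0, t, fun s => φ.symm (z + s • u), ht, ⟨⟨fun s hs =>
    (hγ s hs).continuousAt.continuousWithinAt, ∅, finite_empty, fun s hs =>
    (hγ s (Ioo_subset_Icc_self hs.1)).contMDiffWithinAt⟩, ?_⟩, by simp, rfl⟩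
  convert finite_empty
  refine eq_empty_of_forall_notMem fun s hs => hs.2 ?_
  obtain ⟨hst, w, hw, hwu⟩ := h s hs.1
  have hvel : velocity (d := d) (fun s => φ.symm (z + s • u)) s =
      mfderiv 𝓘(ℝ, EuclideanSpace ℝ (Fin d)) (𝓡 d) φ.symm (z + s • u) u := by
    have hd : HasDerivAt (fun s : ℝ => z + s • u) u s := by
      simpa using ((hasDerivAt_id s).smul_const u).const_add z
    have hc := mfderiv_comp (I := 𝓘(ℝ, ℝ)) (I' := 𝓘(ℝ, EuclideanSpace ℝ (Fin d)))
      (I'' := 𝓡 d) s (g := φ.symm) (f := fun s : ℝ => z + s • u)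
      ((hsymm _ hst).mdifferentiableAt (by simp))
      (hline.contMDiff.contMDiffAt.mdifferentiableAt (by simp))
    have h1 := DFunLike.congr_fun hc (1 : ℝ)
    have h2 : mfderiv 𝓘(ℝ, ℝ) 𝓘(ℝ, EuclideanSpace ℝ (Fin d))
        (fun s : ℝ => z + s • u) s (1 : ℝ) = u := by
      rw [mfderiv_eq_fderiv]
      exact (fderiv_apply_one_eq_deriv (f := fun s : ℝ => z + s • u)).trans hd.deriv
    refine h1.trans ?_
    exact congrArg (mfderiv 𝓘(ℝ, EuclideanSpace ℝ (Fin d)) (𝓡 d) φ.symm (z + s • u)) h2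
  have hsrc := φ.map_target hst
  have hid : mfderiv 𝓘(ℝ, EuclideanSpace ℝ (Fin d)) (𝓡 d) φ.symm (z + s • u) u = w := by
    have hc := mfderiv_comp (I := 𝓡 d) (I' := 𝓘(ℝ, EuclideanSpace ℝ (Fin d)))
      (I'' := 𝓡 d) (φ.symm (z + s • u)) (g := φ.symm) (f := φ)
      (by rw [φ.right_inv hst]; exact (hsymm _ hst).mdifferentiableAt (by simp))
      (mdifferentiableAt_extChartAt (by simpa [φ] using hsrc))
    have hev : φ.symm ∘ φ =ᶠ[𝓝 (φ.symm (z + s • u))] id := by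
      filter_upwards [(isOpen_extChartAt_source (I := 𝓡 d) x₀).mem_nhds hsrc] with y hy
      exact φ.left_inv hy
    rw [hev.mfderiv_eq, mfderiv_id] at hc
    have h1 := DFunLike.congr_fun hc w
    rw [φ.right_inv hst] at h1
    refine Eq.trans ?_ h1.symm
    exact congrArg (mfderiv 𝓘(ℝ, EuclideanSpace ℝ (Fin d)) (𝓡 d) φ.symm (z + s • u)) hwu.symm
  rw [hvel, hid]
  exact hw

/-- Every point has points in its chronological future and past. -/
theorem exists_eventually_strictCausality (hΩ : (interior Ω).Nonempty)
    (C : CausalStructure Ω M) (x₀ : M) :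
    (∃ x₁, ∀ᶠ q : M × M in 𝓝 (x₀, x₁), C.StrictCausality q.1 q.2) ∧
      ∃ x₂, ∀ᶠ q : M × M in 𝓝 (x₂, x₀), C.StrictCausality q.1 q.2 := by
  obtain ⟨v, hv⟩ := C.exists_eventually_mem_image_coneField hΩ x₀
  set φ := extChartAt (𝓡 d) x₀
  have hopen : IsOpen φ.target := isOpen_extChartAt_target x₀
  have hc₀ : φ x₀ ∈ φ.target := mem_extChartAt_target x₀
  have hev : ∀ᶠ q : EuclideanSpace ℝ (Fin d) × EuclideanSpace ℝ (Fin d) in 𝓝 (φ x₀, v),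
      q.1 ∈ φ.target ∧ ∃ w ∈ C.coneField (φ.symm q.1),
        mfderiv (𝓡 d) 𝓘(ℝ, EuclideanSpace ℝ (Fin d)) φ (φ.symm q.1) w = q.2 := by
    have hcont : Tendsto (fun q : EuclideanSpace ℝ (Fin d) × EuclideanSpace ℝ (Fin d) =>
        (φ.symm q.1, q.2)) (𝓝 (φ x₀, v)) (𝓝 (x₀, v)) := by
      refine Tendsto.prodMk_nhds ?_ continuousAt_snd
      have := (continuousAt_extChartAt_symm (I := 𝓡 d) x₀).tendsto
      rw [extChartAt_to_inv] at this
      exact this.comp continuousAt_fst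
    filter_upwards [hcont.eventually hv,
      (continuousAt_fst (p := (φ x₀, v))).eventually (hopen.mem_nhds hc₀)] with q h1 h2
    exact ⟨h2, h1.2⟩
  obtain ⟨δ, hδ, hball⟩ := Metric.eventually_nhds_iff_ball.1 hev
  -- The segment stays in the ball by convexity, and its constant direction is close to `v`, hence
  -- in the cone at each of its points.
  have key : ∀ t : ℝ, 0 < t → ∀ y y' : M, y ∈ φ.source → y' ∈ φ.source →
      φ y ∈ Metric.ball (φ x₀) δ → φ y' ∈ Metric.ball (φ x₀) δ →
      t⁻¹ • (φ y' - φ y) ∈ Metric.ball v δ → C.StrictCausality y y' := by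
    intro t ht y y' hy hy' hb hb' hu
    have h1 : φ y + t • t⁻¹ • (φ y' - φ y) = φ y' := by
      rw [smul_inv_smul₀ ht.ne']; abel
    have := C.strictCausality_of_segment x₀ (z := φ y) (u := t⁻¹ • (φ y' - φ y)) ht ?_
    · rwa [h1, φ.left_inv hy, φ.left_inv hy'] at this
    · intro s hs
      refine hball (φ y + s • t⁻¹ • (φ y' - φ y), t⁻¹ • (φ y' - φ y)) ?_
      rw [← ball_prod_same]
      refine ⟨?_, hu⟩
      have hmem := (convex_ball (φ x₀) δ).add_smul_sub_mem hb hb'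
        (t := s * t⁻¹) ⟨by have := hs.1; positivity, by
          rw [← div_eq_mul_inv]; exact (div_le_one ht).2 hs.2⟩
      rwa [mul_smul] at hmem
  have key' : ∀ t : ℝ, 0 < t → ∀ y y' : M, y ∈ φ.source → y' ∈ φ.source →
      φ y ∈ Metric.ball (φ x₀) δ → φ y' ∈ Metric.ball (φ x₀) δ →
      φ y' - φ y = t • v → ∀ᶠ q : M × M in 𝓝 (y, y'), C.StrictCausality q.1 q.2 := by
    intro t ht y y' hy hy' hb hb' hu
    have c1 : ContinuousAt (fun q : M × M => φ q.1) (y, y') :=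
      ContinuousAt.comp (f := Prod.fst) (continuousAt_extChartAt' hy) continuousAt_fst
    have c2 : ContinuousAt (fun q : M × M => φ q.2) (y, y') :=
      ContinuousAt.comp (f := Prod.snd) (continuousAt_extChartAt' hy') continuousAt_snd
    have c3 : ContinuousAt (fun q : M × M => t⁻¹ • (φ q.2 - φ q.1)) (y, y') :=
      (c2.fun_sub c1).fun_const_smul _
    have hv' : t⁻¹ • (φ y' - φ y) = v := by rw [hu, inv_smul_smul₀ ht.ne']
    filter_upwards [continuousAt_fst.eventually
        ((isOpen_extChartAt_source (I := 𝓡 d) x₀).mem_nhds hy),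
      continuousAt_snd.eventually ((isOpen_extChartAt_source (I := 𝓡 d) x₀).mem_nhds hy'),
      c1.eventually (Metric.isOpen_ball.mem_nhds hb),
      c2.eventually (Metric.isOpen_ball.mem_nhds hb'),
      c3.eventually ((Metric.isOpen_ball (x := v) (ε := δ)).mem_nhds
        (by simpa only [hv'] using Metric.mem_ball_self hδ))] with q h1 h2 h3 h4 h5
    exact key t ht _ _ h1 h2 h3 h4 h5
  have hsmall : ∃ t : ℝ, 0 < t ∧ φ x₀ + t • v ∈ Metric.ball (φ x₀) δ ∧
      φ x₀ - t • v ∈ Metric.ball (φ x₀) δ := by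
    have c1 : Tendsto (fun t : ℝ => φ x₀ + t • v) (𝓝[>] 0) (𝓝 (φ x₀)) := by
      refine Tendsto.mono_left ?_ nhdsWithin_le_nhds
      exact Continuous.tendsto' (by fun_prop) _ _ (by simp)
    have c2 : Tendsto (fun t : ℝ => φ x₀ - t • v) (𝓝[>] 0) (𝓝 (φ x₀)) := by
      refine Tendsto.mono_left ?_ nhdsWithin_le_nhds
      exact Continuous.tendsto' (by fun_prop) _ _ (by simp)
    have := (c1.eventually (Metric.ball_mem_nhds _ hδ)).and
      ((c2.eventually (Metric.ball_mem_nhds _ hδ)).and self_mem_nhdsWithin)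
    obtain ⟨t, h1, h2, h3⟩ := this.exists
    exact ⟨t, h3, h1, h2⟩
  obtain ⟨t, ht, hp, hm⟩ := hsmall
  have htgt : ∀ z ∈ Metric.ball (φ x₀) δ, z ∈ φ.target := fun z hz =>
    (hball (z, v) (by
      rw [← ball_prod_same]; exact ⟨hz, Metric.mem_ball_self hδ⟩)).1
  refine ⟨⟨φ.symm (φ x₀ + t • v), key' t ht _ _ (mem_extChartAt_source x₀)
    (φ.map_target (htgt _ hp)) (Metric.mem_ball_self hδ) ?_ ?_⟩,
    ⟨φ.symm (φ x₀ - t • v), key' t ht _ _ (φ.map_target (htgt _ hm))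
      (mem_extChartAt_source x₀) ?_ (Metric.mem_ball_self hδ) ?_⟩⟩
  · rwa [φ.right_inv (htgt _ hp)]
  · rw [φ.right_inv (htgt _ hp)]; abel
  · rwa [φ.right_inv (htgt _ hm)]
  · rw [φ.right_inv (htgt _ hm)]; abel

end CausalStructure
end QuasiTotal

/-! ### Transport and lifting of causal curves -/

namespace QuasiTotal
namespace CausalStructure

open Filter

variable {d : ℕ} {Ω : Set (EuclideanSpace ℝ (Fin d))}
  {M : Type*} [TopologicalSpace M] [ChartedSpace (EuclideanSpace ℝ (Fin d)) M]
  [IsManifold (𝓡 d) ∞ M]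
  {N : Type*} [TopologicalSpace N] [ChartedSpace (EuclideanSpace ℝ (Fin d)) N]
  [IsManifold (𝓡 d) ∞ N]

theorem Causality.of_strict {C : CausalStructure Ω M} {x y : M} (h : C.StrictCausality x y) :
    C.Causality x y :=
  subset_closure h

/-- Smooth maps whose differentials respect the cones map causal curves to causal curves. -/
theorem StrictCausality.map {C : CausalStructure Ω M} {D : CausalStructure Ω N} {f : M → N}
    (hf : ContMDiff (𝓡 d) (𝓡 d) ∞ f)
    (hcone : ∀ x, mfderiv (𝓡 d) (𝓡 d) f x '' C.coneField x ⊆ D.coneField (f x)) {x y : M}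
    (h : C.StrictCausality x y) : D.StrictCausality (f x) (f y) := by
  obtain ⟨a, b, γ, hab, ⟨⟨hc, S, hS, hsm⟩, hfin⟩, rfl, rfl⟩ := h
  refine ⟨a, b, f ∘ γ, hab, ⟨⟨hf.continuous.comp_continuousOn hc, S, hS,
    hf.comp_contMDiffOn hsm⟩, ?_⟩, rfl, rfl⟩
  -- The endpoints are discarded along with `S`: nothing makes `γ` two-sidedly differentiable there.
  refine ((hfin.union hS).union (toFinite {a, b})).subset fun t ht => ?_
  by_contra hcon
  simp only [mem_union, mem_insert_iff, mem_singleton_iff, not_or] at hcon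
  obtain ⟨⟨h1, h2⟩, h3, h4⟩ := hcon
  have hto : t ∈ Ioo a b \ S := ⟨⟨lt_of_le_of_ne ht.1.1 (Ne.symm h3),
    lt_of_le_of_ne ht.1.2 h4⟩, h2⟩
  have hd : MDifferentiableAt 𝓘(ℝ, ℝ) (𝓡 d) γ t :=
    (hsm.contMDiffAt ((isOpen_Ioo.sdiff hS.isClosed).mem_nhds hto)).mdifferentiableAt (by simp)
  have hv : velocity (d := d) γ t ∈ C.coneField (γ t) := by
    by_contra hv
    exact h1 ⟨ht.1, hv⟩
  refine ht.2 (hcone _ ⟨_, hv, ?_⟩)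
  exact (DFunLike.congr_fun (mfderiv_comp (I := 𝓘(ℝ, ℝ)) (I' := 𝓡 d) (I'' := 𝓡 d) t
    (hf.mdifferentiable (by simp) (γ t)) hd) (1 : ℝ)).symm

theorem Causality.map {C : CausalStructure Ω M} {D : CausalStructure Ω N} {f : M → N}
    (hf : ContMDiff (𝓡 d) (𝓡 d) ∞ f)
    (hcone : ∀ x, mfderiv (𝓡 d) (𝓡 d) f x '' C.coneField x ⊆ D.coneField (f x)) {x y : M}
    (h : C.Causality x y) : D.Causality (f x) (f y) :=
  map_mem_closure (f := Prod.map f f) (hf.continuous.prodMap hf.continuous) h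
    fun _ hq => StrictCausality.map hf hcone hq

/-- Causal diffeomorphisms are automorphisms of the causality. -/
theorem causality_causalGroup_iff (C : CausalStructure Ω M) {φ : Equiv.Perm M}
    (hφ : φ ∈ C.causalGroup) {x y : M} : C.Causality (φ x) (φ y) ↔ C.Causality x y := by
  refine ⟨fun h => ?_, fun h => h.map hφ.1 fun z => (hφ.2.2 z).subset⟩
  have hi := C.causalGroup.inv_mem hφ
  simpa using h.map hi.1 fun z => (hi.2.2 z).subset

/-- Lifting of causal curves along coverings that respect the cones. -/
theorem StrictCausality.exists_lift {C : CausalStructure Ω M} {D : CausalStructure Ω N}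
    {p : M → N} (hcov : IsCoveringMap p) (hloc : IsLocalDiffeomorph (𝓡 d) (𝓡 d) ∞ p)
    (hcone : ∀ x, mfderiv (𝓡 d) (𝓡 d) p x '' C.coneField x = D.coneField (p x))
    {x : M} {y : N} (h : D.StrictCausality (p x) y) :
    ∃ z, p z = y ∧ C.StrictCausality x z := by
  obtain ⟨a, b, γ, hab, ⟨⟨hc, S, hS, hsm⟩, hfin⟩, hx, rfl⟩ := h
  let β : C(unitInterval, N) :=
    ⟨fun t => γ (a + t * (b - a)), hc.comp_continuous (by fun_prop) fun t => by
      have h0 := t.2.1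
      have h1 := t.2.2
      constructor <;> nlinarith⟩
  obtain ⟨Γ, hΓ, hΓ0⟩ := hcov.exists_path_lifts β x (by simpa [β] using hx)
  -- Rescaled lift, extended by constants outside `[a, b]` so that it is continuous on all of `ℝ`.
  let σ : ℝ → M := fun t => Γ (projIcc 0 1 zero_le_one ((t - a) / (b - a)))
  have hba : b - a ≠ 0 := (sub_pos.2 hab).ne'
  have hσc : Continuous σ := by fun_prop
  have hpσ : ∀ t ∈ Icc a b, p (σ t) = γ t := by
    intro t ht
    have hmem : (t - a) / (b - a) ∈ Icc (0 : ℝ) 1 :=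
      ⟨div_nonneg (sub_nonneg.2 ht.1) (sub_pos.2 hab).le,
        (div_le_one (sub_pos.2 hab)).2 (by linarith [ht.2])⟩
    refine (congrFun hΓ _).trans ?_
    rw [projIcc_of_mem _ hmem]
    change γ (a + (t - a) / (b - a) * (b - a)) = γ t
    rw [div_mul_cancel₀ _ hba, add_sub_cancel]
  have hσs : ∀ t ∈ Ioo a b \ S, ContMDiffAt 𝓘(ℝ, ℝ) (𝓡 d) ∞ σ t := by
    intro t ht
    have hγt : ContMDiffAt 𝓘(ℝ, ℝ) (𝓡 d) ∞ γ t :=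
      hsm.contMDiffAt ((isOpen_Ioo.sdiff hS.isClosed).mem_nhds ht)
    have hpt := hpσ t (Ioo_subset_Icc_self ht.1)
    have hinv := (hloc (σ t)).localInverse_contMDiffAt
    rw [hpt] at hinv
    -- Near `t`, the lift is a smooth local inverse of `p` composed with `γ`.
    refine (hinv.comp t hγt).congr_of_eventuallyEq ?_
    filter_upwards [isOpen_Ioo.mem_nhds ht.1,
      hσc.continuousAt.eventually (hloc (σ t)).localInverse_eventuallyEq_left] with s hs h1
    have h2 : (hloc (σ t)).localInverse (p (σ s)) = σ s := h1
    rw [hpσ s (Ioo_subset_Icc_self hs)] at h2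
    exact h2.symm
  have hσa : σ a = x := by simpa [σ] using hΓ0
  refine ⟨σ b, hpσ b (right_mem_Icc.2 hab.le), a, b, σ, hab, ⟨⟨hσc.continuousOn, S, hS,
    fun t ht => (hσs t ht).contMDiffWithinAt⟩, ?_⟩, hσa, rfl⟩
  refine ((hfin.union hS).union (toFinite {a, b})).subset fun t ht => ?_
  by_contra hcon
  simp only [mem_union, mem_insert_iff, mem_singleton_iff, not_or] at hcon
  obtain ⟨⟨h1, h2⟩, h3, h4⟩ := hcon
  have hto : t ∈ Ioo a b \ S := ⟨⟨lt_of_le_of_ne ht.1.1 (Ne.symm h3),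
    lt_of_le_of_ne ht.1.2 h4⟩, h2⟩
  have hv : velocity (d := d) γ t ∈ D.coneField (γ t) := by
    by_contra hv
    exact h1 ⟨ht.1, hv⟩
  have hev : p ∘ σ =ᶠ[𝓝 t] γ := by
    filter_upwards [isOpen_Ioo.mem_nhds hto.1] with s hs
    exact hpσ s (Ioo_subset_Icc_self hs)
  have hvel : velocity (d := d) (p ∘ σ) t =
      mfderiv (𝓡 d) (𝓡 d) p (σ t) (velocity (d := d) σ t) :=
    DFunLike.congr_fun (mfderiv_comp (I := 𝓘(ℝ, ℝ)) (I' := 𝓡 d) (I'' := 𝓡 d) t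
      ((hloc (σ t)).mdifferentiableAt (by simp))
      ((hσs t hto).mdifferentiableAt (by simp))) (1 : ℝ)
  have hv' : velocity (d := d) (p ∘ σ) t ∈ D.coneField ((p ∘ σ) t) := by
    have h5 : velocity (d := d) (p ∘ σ) t = velocity (d := d) γ t :=
      DFunLike.congr_fun hev.mfderiv_eq (1 : ℝ)
    have h6 : (p ∘ σ) t = γ t := hev.eq_of_nhds
    rw [h5, h6]
    exact hv
  rw [hvel] at hv'
  change _ ∈ D.coneField (p (σ t)) at hv'
  rw [← hcone] at hv'
  obtain ⟨w, hw, hwe⟩ := hv'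
  have hinj := ((hloc (σ t)).mfderivToContinuousLinearEquiv (by simp)).injective
  exact ht.2 (hinj hwe ▸ hw)

end CausalStructure
end QuasiTotal

/-! ### Uniform bound from compactness -/

namespace QuasiTotal

open Filter

/-- If some point `o` is comparable to suitable translates of every point, locally uniformly and
modulo a group generated by an increasing automorphism `T` with compact quotient, then any two
points are comparable after a bounded power of `T`. -/
theorem exists_uniform_bound_of_locally {X Y : Type*} [TopologicalSpace X] [TopologicalSpace Y]
    [CompactSpace Y] {r : X → X → Prop} [IsTrans X r] {T : Equiv.Perm X} {p : X → Y}
    (hp : IsOpenQuotientMap p) (hfib : ∀ x y, p x = p y → ∃ k : ℤ, (T ^ k) y = x)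
    (hr : ∀ (k : ℤ) (x y : X), r x y → r ((T ^ k) x) ((T ^ k) y))
    (hmono : ∀ (k : ℕ) (x : X), r x ((T ^ k) x)) (o : X)
    (ho : ∀ x, ∃ m n : ℕ, ∀ᶠ y in 𝓝 x, r o ((T ^ m) y) ∧ r y ((T ^ n) o)) :
    ∃ N : ℕ, ∀ a b : X, r a ((T ^ N) b) ∨ r b ((T ^ N) a) := by
  have htr : ∀ {x y z : X}, r x y → r y z → r x z := fun h h' => _root_.trans h h'
  choose m n hmn using ho
  have hU : ∀ x, p '' {y | r o ((T ^ m x) y) ∧ r y ((T ^ n x) o)} ∈ 𝓝 (p x) := fun x =>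
    hp.isOpenMap.image_mem_nhds (hmn x)
  choose g hg using hp.surjective
  obtain ⟨t, ht⟩ := CompactSpace.elim_nhds_subcover
    (fun q => p '' {y | r o ((T ^ m (g q)) y) ∧ r y ((T ^ n (g q)) o)})
    (fun q => by simpa only [hg] using hU (g q))
  set B : ℕ := t.sup (fun q => m (g q) + n (g q))
  have hgrow : ∀ {i j : ℕ} (x : X), i ≤ j → r ((T ^ i) x) ((T ^ j) x) := by
    intro i j x hij
    obtain ⟨k, rfl⟩ := Nat.exists_eq_add_of_le' hij
    rw [pow_add, Equiv.Perm.mul_apply]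
    exact hmono k _
  have hbase : ∀ a, ∃ k : ℤ, r o ((T ^ B) ((T ^ k) a)) ∧ r ((T ^ k) a) ((T ^ B) o) := by
    intro a
    have ha : p a ∈ (⊤ : Set Y) := mem_univ _
    rw [← ht] at ha
    obtain ⟨q, hq, y, ⟨h1, h2⟩, hy⟩ := mem_iUnion₂.1 ha
    obtain ⟨k, rfl⟩ := hfib y a hy
    have hqB : m (g q) + n (g q) ≤ B := Finset.le_sup (f := fun q => m (g q) + n (g q)) hq
    exact ⟨k, htr h1 (hgrow _ (by omega)), htr h2 (hgrow _ (by omega))⟩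
  -- The chain is `a ≼ T^(B-i) o ≼ T^(2B-i+j) b ≼ T^(2B) b`, the last step using `j ≤ i`.
  have key : ∀ (a b : X) (i j : ℤ), r ((T ^ i) a) ((T ^ B) o) → r o ((T ^ B) ((T ^ j) b)) →
      j ≤ i → r a ((T ^ (2 * B)) b) := by
    intro a b i j h1 h2 hij
    obtain ⟨l, hl⟩ := Int.eq_ofNat_of_zero_le (sub_nonneg.2 hij)
    have h3 := htr (hr (-i) _ _ h1) (hr (-i) _ _ (by simpa using hr B _ _ h2))
    have h4 := htr h3 (hmono l _)
    simp only [← Equiv.Perm.mul_apply, ← zpow_natCast, ← zpow_add] at h4 ⊢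
    rw [neg_add_cancel, zpow_zero, Equiv.Perm.one_apply] at h4
    convert! h4 using 3
    push_cast
    omega
  refine ⟨2 * B, fun a b => ?_⟩
  obtain ⟨i, hi1, hi2⟩ := hbase a
  obtain ⟨j, hj1, hj2⟩ := hbase b
  rcases le_total j i with h | h
  · exact Or.inl (key a b i j hi2 hj1 h)
  · exact Or.inr (key b a j i hj2 hi1 h)

/-! ### Application to causal coverings -/

section Coverings

variable {d : ℕ} {Ω : Set (EuclideanSpace ℝ (Fin d))}
  {Mt : Type*} [TopologicalSpace Mt] [ChartedSpace (EuclideanSpace ℝ (Fin d)) Mt]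
  [IsManifold (𝓡 d) ∞ Mt]
  {M : Type*} [TopologicalSpace M] [ChartedSpace (EuclideanSpace ℝ (Fin d)) M]
  [IsManifold (𝓡 d) ∞ M]
  {Ct : CausalStructure Ω Mt} {C : CausalStructure Ω M} {T : Ct.causalGroup} {p : Mt → M}

theorem IsCausalCovering.exists_zpow_of_apply_eq (hp : IsCausalCovering Ct C T p) {x y : Mt}
    (h : p x = p y) : ∃ k : ℤ, ((T : Equiv.Perm Mt) ^ k) y = x := by
  obtain ⟨⟨_, k, rfl⟩, hk⟩ := hp.isQuotientCoveringMap.apply_eq_iff_mem_orbit.1 h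
  exact ⟨k, by simpa using! hk⟩

/-- A fixed point would make every neighbourhood of it meet its `T`-translate, forcing `T = 1`. -/
theorem IsCausalCovering.apply_ne (hp : IsCausalCovering Ct C T p) (x : Mt) :
    (T : Equiv.Perm Mt) x ≠ x := by
  intro h
  obtain ⟨U, hU, hdisj⟩ := hp.isQuotientCoveringMap.disjoint x
  have h1 := hdisj ⟨T, Subgroup.mem_zpowers T⟩
    ⟨x, ⟨x, mem_of_mem_nhds hU, h⟩, mem_of_mem_nhds hU⟩
  have h2 : T = 1 := congrArg Subtype.val h1
  exact hp.infinite_order (h2 ▸ IsOfFinOrder.one)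

/-- By total acausality of the base, any two points upstairs are related up to a deck
transformation. -/
theorem IsCausalCovering.exists_causality_zpow (hΩ : (interior Ω).Nonempty)
    (hp : IsCausalCovering Ct C T p) (a b : Mt) :
    ∃ k : ℤ, Ct.Causality a (((T : Equiv.Perm Mt) ^ k) b) := by
  have : IsPartialOrder Mt Ct.Causality := hp.isCausal
  obtain ⟨⟨a', ha'⟩, -⟩ := Ct.exists_eventually_strictCausality hΩ a
  obtain ⟨-, ⟨b', hb'⟩⟩ := Ct.exists_eventually_strictCausality hΩ b
  have hq := hp.isQuotientCoveringMap.isOpenQuotientMap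
  have hA := hq.isOpenMap.image_mem_nhds (ha'.curry_nhds.self_of_nhds)
  have hB := hq.isOpenMap.image_mem_nhds
    (((continuous_id.prodMk continuous_const).tendsto' b' (b', b) rfl).eventually hb')
  -- Here `x` is near `a'` and `y` near `b'`, with a causal curve from `p x` to `p y`. Its lift ends
  -- at some `T^k y`, so `a ≼ x ≼ T^k y ≼ T^k b`.
  obtain ⟨⟨_, _⟩, ⟨⟨x, hx, rfl⟩, ⟨y, hy, rfl⟩⟩, hxy⟩ :=
    mem_closure_iff_nhds.1 (hp.isTotallyAcausal (p a') (p b')) _ (prod_mem_nhds hA hB)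
  obtain ⟨z, hz, hxz⟩ := CausalStructure.StrictCausality.exists_lift
    hp.isQuotientCoveringMap.isCoveringMap hp.isLocalDiffeomorph hp.map_coneField hxy
  obtain ⟨k, rfl⟩ := hp.exists_zpow_of_apply_eq hz
  refine ⟨k, _root_.trans (r := Ct.Causality) (.of_strict hx)
    (_root_.trans (r := Ct.Causality) (.of_strict hxz) ?_)⟩
  exact (Ct.causality_causalGroup_iff (zpow_mem T.2 k)).2 (.of_strict hy)

theorem IsCompleteCausalCovering.causality_pow (hp : IsCompleteCausalCovering Ct C T p)
    (k : ℕ) (x : Mt) : Ct.Causality x (((T : Equiv.Perm Mt) ^ k) x) := by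
  have : IsPartialOrder Mt Ct.Causality := hp.isCausal
  induction k with
  | zero => exact refl_of Ct.Causality x
  | succ k ih =>
    rw [pow_succ', Equiv.Perm.mul_apply]
    exact _root_.trans (r := Ct.Causality) ih (hp.complete _)

theorem IsCompleteCausalCovering.exists_causality_pow (hΩ : (interior Ω).Nonempty)
    (hp : IsCompleteCausalCovering Ct C T p) (a b : Mt) :
    ∃ n : ℕ, Ct.Causality a (((T : Equiv.Perm Mt) ^ n) b) := by
  have : IsPartialOrder Mt Ct.Causality := hp.isCausal
  obtain ⟨k, hk⟩ := hp.exists_causality_zpow hΩ a b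
  refine ⟨k.toNat, ?_⟩
  have h := hp.causality_pow (k.toNat - k).toNat (((T : Equiv.Perm Mt) ^ k) b)
  rw [← Equiv.Perm.mul_apply, ← zpow_natCast, ← zpow_add,
    Int.toNat_of_nonneg (sub_nonneg.2 (Int.self_le_toNat k)), sub_add_cancel, zpow_natCast] at h
  exact _root_.trans (r := Ct.Causality) hk h

theorem IsCompleteCausalCovering.isDominant (hΩ : (interior Ω).Nonempty)
    (hp : IsCompleteCausalCovering Ct C T p) :
    IsDominant Ct.Causality (T : Equiv.Perm Mt) := by
  intro a b
  have : IsPartialOrder Mt Ct.Causality := hp.isCausal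
  obtain ⟨n, hn⟩ := hp.exists_causality_pow hΩ b a
  have h1 := hp.complete (((T : Equiv.Perm Mt) ^ n) a)
  have hne := hp.apply_ne (((T : Equiv.Perm Mt) ^ n) a)
  have hle : Ct.Causality b (((T : Equiv.Perm Mt) ^ (n + 1)) a) := by
    rw [pow_succ', Equiv.Perm.mul_apply]
    exact _root_.trans (r := Ct.Causality) hn h1
  -- The extra power gives strictness: if `b = T^(n+1) a`, then `T^n a` and its image under `T`
  -- precede each other, so `T` fixes `T^n a`.
  refine ⟨n + 1, n.succ_pos, hle, fun heq => hne ?_⟩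
  rw [pow_succ', Equiv.Perm.mul_apply] at heq
  exact antisymm_of Ct.Causality (heq ▸ hn) h1

theorem IsCompleteCausalCovering.exists_uniform_bound [CompactSpace M]
    (hΩ : (interior Ω).Nonempty) (hp : IsCompleteCausalCovering Ct C T p) :
    ∃ N : ℕ, ∀ a b : Mt, Ct.Causality a (((T : Equiv.Perm Mt) ^ N) b) ∨
      Ct.Causality b (((T : Equiv.Perm Mt) ^ N) a) := by
  have : IsPartialOrder Mt Ct.Causality := hp.isCausal
  rcases isEmpty_or_nonempty Mt with _ | ⟨⟨o⟩⟩
  · exact ⟨0, fun a => isEmptyElim a⟩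
  refine exists_uniform_bound_of_locally hp.isQuotientCoveringMap.isOpenQuotientMap
    (fun _ _ => hp.exists_zpow_of_apply_eq)
    (fun k _ _ h => (Ct.causality_causalGroup_iff (zpow_mem T.2 k)).2 h)
    hp.causality_pow o fun x => ?_
  obtain ⟨⟨x₁, h₁⟩, ⟨x₂, h₂⟩⟩ := Ct.exists_eventually_strictCausality hΩ x
  obtain ⟨m, hm⟩ := hp.exists_causality_pow hΩ o x₂
  obtain ⟨n, hn⟩ := hp.exists_causality_pow hΩ x₁ o
  -- For all `y` near `x`, `o ≼ T^m x₂ ≼ T^m y` and `y ≼ x₁ ≼ T^n o`.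
  refine ⟨m, n, ?_⟩
  filter_upwards [((continuous_id.prodMk continuous_const).tendsto' x (x, x₁) rfl).eventually h₁,
    h₂.curry_nhds.self_of_nhds] with y hy₁ hy₂
  exact ⟨_root_.trans (r := Ct.Causality) hm
    ((Ct.causality_causalGroup_iff (pow_mem T.2 m)).2 (.of_strict hy₂)),
    _root_.trans (r := Ct.Causality) (.of_strict hy₁) hn⟩

end Coverings

end QuasiTotal

theorem mainTheorem11 {d : ℕ} {Ω : Set (EuclideanSpace ℝ (Fin d))}
    (hΩ : QuasiTotal.IsClosedRegularCone Ω)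
    {Mt : Type*} [TopologicalSpace Mt] [ChartedSpace (EuclideanSpace ℝ (Fin d)) Mt]
    [IsManifold (𝓡 d) ∞ Mt]
    {M : Type*} [TopologicalSpace M] [ChartedSpace (EuclideanSpace ℝ (Fin d)) M]
    [IsManifold (𝓡 d) ∞ M] [CompactSpace M]
    (Ct : QuasiTotal.CausalStructure Ω Mt) (C : QuasiTotal.CausalStructure Ω M)
    (T : Ct.causalGroup) (p : Mt → M)
    (hp : QuasiTotal.IsCompleteCausalCovering Ct C T p) :
    QuasiTotal.IsQuasiTotalCausalCovering Ct C T p := by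
  obtain ⟨N, hN⟩ := hp.exists_uniform_bound hΩ.regular
  exact ⟨hp.toIsCausalCovering, hp.isCausal, fun _ _ => Ct.causality_causalGroup_iff T.2,
    hp.isDominant hΩ.regular, N, fun a b => ⟨N, le_rfl, hN a b⟩⟩
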